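/- Let $T$ be Chacon's map, constructed by cutting and stacking: let $h_0=1$, $h_{n+1}=3h_n+1$ and $w_n=2/3^{n+1}$. The stage-$0$ tower is the interval $[0,2/3)$; the stage-$n$ tower is a column of $h_n$ disjoint intervals of length $w_n$ that fill $[0,h_nw_n)$, and the stage-$(n+1)$ tower is obtained from it by cutting it into three subcolumns of equal width, placing one spacer interval, the leftmost interval of length $w_{n+1}$ of the remaining part $[h_nw_n,1)$, above the middle subcolumn, and stacking the subcolumns from left to right. $T$ translates every level of every tower, except the top one, onto the level above it. It is a bijection of the set $Y$ obtained from $[0,1)$ by removing the countably many left endpoints of levels; let $\nu$ be Lebesgue measure on $Y$. Let $X=Y\times Y$, $\mu=\nu\times\nu$, and $\mathbf T^{(v_1,v_2)}(x,y)=(T^{v_1}x,T^{v_2}y)$ for $(v_1,v_2)\in\mathbb Z^2$. **Theorem.** $(X,\mu)$ is a Lebesgue probability space, and $\mathbf T$ is a measure-preserving $\mathbb Z^2$-action on it which is Følner rank one and not totally ergodic, but which does not factor onto any nontrivial finite $\mathbb Z^2$-odometer. In particular, there is a Følner rank one $\mathbb Z^2$-action that is not totally ergodic and has no nontrivial finite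 odometer factor. Here a measure-preserving $\mathbb Z^d$-action $\mathbf S$ on a probability space $(X,\mu)$ is * *Følner rank one* if there are nonempty finite sets $F_n\subset\mathbb Z^d$ with $\#(F_n\,\triangle\,(F_n+v))/\#F_n\to0$ for every $v\in\mathbb Z^d$, and measurable sets $B_n$ with $\mu(B_n)>0$ such that for each $n$ the sets $\mathbf S^vB_n$ ($v\in F_n$) are pairwise disjoint, and for every measurable $A$ there are sets $L_n$, each a union of some of the sets $\mathbf S^vB_n$ ($v\in F_n$), with $\mu(L_n\,\triangle\,A)\to0$; * *totally ergodic* if $\mathbf S^v$ is ergodic for every $v\neq0$. It *factors onto* an action $\mathbf R$ on $(Z,\zeta)$ if there is a measurable $\phi:X\to Z$ with $\phi_*\mu=\zeta$ and, for every $v$, $\phi\circ\mathbf S^v=\mathbf R^v\circ\phi$ almost everywhere; if $\phi$ can be chosen almost surely one-to-one, the two actions are *conjugate*. A *nontrivial finite $\mathbb Z^d$-odometer* is an action conjugate to the action of $\mathbb Z^d$ by translations on $\mathbb Z^d/G$ with the uniform probability measure, for some proper subgroup $G$ of finite index. -/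

import Mathlib

open MeasureTheory Filter Topology
open scoped Pointwise

noncomputable section

namespace RankOne

/-! ### Measure-preserving actions of `ℤ^d`

An action of the group `Γ` on `X` is an `AddAction Γ X`; the transformation attached to `v : Γ`
is `x ↦ v +ᵥ x`, and `v +ᵥ B` is the image of the set `B` under it. -/

/-- A Lebesgue probability space: a standard Borel space with a non-atomic probability measure. -/
structure IsLebesgueProbabilitySpace (X : Type*) [MeasurableSpace X] (μ : Measure X) : Prop where
  standardBorel : StandardBorelSpace X
  isProbabilityMeasure : IsProbabilityMeasure μ
  nonatomic : ∀ x : X, μ {x} = 0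

/-- Every transformation of the action is measurable and preserves the measure. -/
def IsMeasurePreservingAction (Γ : Type*) [AddGroup Γ] {X : Type*} [MeasurableSpace X]
    [AddAction Γ X] (μ : Measure X) : Prop :=
  ∀ v : Γ, MeasurePreserving (fun x : X => v +ᵥ x) μ μ

/-- The action is totally ergodic: the transformation attached to each nonzero group element
is ergodic. -/
def IsTotallyErgodic (Γ : Type*) [AddGroup Γ] {X : Type*} [MeasurableSpace X]
    [AddAction Γ X] (μ : Measure X) : Prop :=
  ∀ v : Γ, v ≠ 0 → Ergodic (fun x : X => v +ᵥ x) μ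

/-- `φ` is a factor map from `(X, μ)` onto `(Y, ν)`. -/
structure IsFactorMap (Γ : Type*) [AddGroup Γ] {X Y : Type*} [MeasurableSpace X]
    [MeasurableSpace Y] [AddAction Γ X] [AddAction Γ Y] (μ : Measure X) (ν : Measure Y)
    (φ : X → Y) : Prop where
  measurable : Measurable φ
  map_eq : μ.map φ = ν
  equivariant : ∀ v : Γ, ∀ᵐ x ∂μ, φ (v +ᵥ x) = v +ᵥ φ x

/-- The system on `(X, μ)` factors onto the system on `(Y, ν)`. -/
def FactorsOnto (Γ : Type*) [AddGroup Γ] {X Y : Type*} [MeasurableSpace X]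
    [MeasurableSpace Y] [AddAction Γ X] [AddAction Γ Y] (μ : Measure X) (ν : Measure Y) : Prop :=
  ∃ φ : X → Y, IsFactorMap Γ μ ν φ

/-- The two systems are conjugate: there is a factor map which is almost surely one-to-one. -/
def IsConjugateTo (Γ : Type*) [AddGroup Γ] {X Y : Type*} [MeasurableSpace X]
    [MeasurableSpace Y] [AddAction Γ X] [AddAction Γ Y] (μ : Measure X) (ν : Measure Y) : Prop :=
  ∃ φ : X → Y, IsFactorMap Γ μ ν φ ∧ ∃ X₀ : Set X, (∀ᵐ x ∂μ, x ∈ X₀) ∧ Set.InjOn φ X₀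

/-- The system on `(Z, ζ)` is a finite `ℤ^d`-odometer with group `G`: `G` has finite index and the
system is conjugate to the action of `ℤ^d` by translations on `ℤ^d / G`, with its uniform
probability measure. -/
def IsFiniteOdometer {d : ℕ} (G : AddSubgroup (Fin d → ℤ)) {Z : Type*} [MeasurableSpace Z]
    [AddAction (Fin d → ℤ) Z] (ζ : Measure Z) : Prop :=
  G.FiniteIndex ∧ IsConjugateTo (Fin d → ℤ) ζ
    (ProbabilityTheory.uniformOn (Set.univ : Set ((Fin d → ℤ) ⧸ G)))

/-- A nontrivial finite `ℤ^d`-odometer: one whose group is a proper subgroup of `ℤ^d`. -/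
def IsNontrivialFiniteOdometer (d : ℕ) {Z : Type*} [MeasurableSpace Z]
    [AddAction (Fin d → ℤ) Z] (ζ : Measure Z) : Prop :=
  ∃ G : AddSubgroup (Fin d → ℤ), G ≠ ⊤ ∧ IsFiniteOdometer G ζ

/-! ### Rank one -/

/-- A Følner sequence of shapes (nonempty finite subsets of `ℤ^d`). -/
structure IsFolnerSequence {d : ℕ} (F : ℕ → Finset (Fin d → ℤ)) : Prop where
  nonempty : ∀ n, (F n).Nonempty
  tendsto : ∀ v : Fin d → ℤ,
    Tendsto (fun n => ((symmDiff (F n) (v +ᵥ F n)).card : ℝ) / ((F n).card : ℝ)) atTop (𝓝 0)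

/-- `B` is the base of a tower of shape `R`. -/
structure IsTowerBase {d : ℕ} {X : Type*} [MeasurableSpace X] [AddAction (Fin d → ℤ) X]
    (μ : Measure X) (R : Finset (Fin d → ℤ)) (B : Set X) : Prop where
  measurableSet : MeasurableSet B
  pos : 0 < μ B
  disjoint : ∀ v₁ ∈ R, ∀ v₂ ∈ R, v₁ ≠ v₂ → Disjoint (v₁ +ᵥ B) (v₂ +ᵥ B)

/-- The action is rank one for the sequence of shapes `F`: there are towers of these shapes such
that every measurable set is approximated by unions of levels of the towers. -/
def IsRankOneFor {d : ℕ} {X : Type*} [MeasurableSpace X] [AddAction (Fin d → ℤ) X]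
    (μ : Measure X) (F : ℕ → Finset (Fin d → ℤ)) : Prop :=
  (∀ n, (F n).Nonempty) ∧
  ∃ B : ℕ → Set X, (∀ n, IsTowerBase μ (F n) (B n)) ∧
    ∀ A : Set X, MeasurableSet A →
      ∃ S : ℕ → Finset (Fin d → ℤ), (∀ n, S n ⊆ F n) ∧
        Tendsto (fun n => μ (symmDiff (⋃ v ∈ S n, v +ᵥ B n) A)) atTop (𝓝 0)

/-- The action is Følner rank one. -/
def IsFolnerRankOne (d : ℕ) {X : Type*} [MeasurableSpace X] [AddAction (Fin d → ℤ) X]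
    (μ : Measure X) : Prop :=
  ∃ F : ℕ → Finset (Fin d → ℤ), IsFolnerSequence F ∧ IsRankOneFor μ F

end RankOne

namespace Chacon

/-! ### Chacon's map, by cutting and stacking intervals

The tower of stage `n` is a column of `height n` intervals of length `width n`; it fills
`[0, height n * width n)`, and the rest of `[0, 1)` is the reservoir of spacers. The tower of
stage `0` is the single interval `[0, 2/3)`. To pass to stage `n + 1`, cut the tower into three
subcolumns of equal width, put one spacer (the leftmost interval of the reservoir) above the
middle subcolumn, and stack the subcolumns from left to right. -/

/-- The number of levels of the tower of stage `n`. -/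
def height : ℕ → ℕ
  | 0 => 1
  | n + 1 => 3 * height n + 1

/-- The length of each level of the tower of stage `n`. -/
def width (n : ℕ) : ℝ := 2 / 3 ^ (n + 1)

/-- The left endpoint of level `j < height n` (counted from the bottom) of the tower of
stage `n`. -/
def left : ℕ → ℕ → ℝ
  | 0, _ => 0
  | n + 1, j =>
    if j < height n then left n j
    else if j < 2 * height n then left n (j - height n) + width (n + 1)
    else if j = 2 * height n then height n * width n
    else left n (j - (2 * height n + 1)) + 2 * width (n + 1)

/-- Level `j` of the tower of stage `n`. -/
def level (n j : ℕ) : Set ℝ := Set.Ico (left n j) (left n j + width n)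

/-- At stage `n`, the map sends each level except the top one by translation to the level
above it. -/
def Step (n : ℕ) (x y : ℝ) : Prop :=
  ∃ j, j + 1 < height n ∧ x ∈ level n j ∧ y = x - left n j + left n (j + 1)

/-- The phase space: `[0, 1)` without the countable set of left endpoints of levels (the forward
orbit of `0`, the one point of `[0, 1)` without a preimage). -/
def space : Set ℝ := {x | x ∈ Set.Ico (0 : ℝ) 1 ∧ ∀ n j, j < height n → x ≠ left n j}

theorem width_pos (n : ℕ) : 0 < width n := by unfold width; positivity

theorem width_succ (n : ℕ) : width n = 3 * width (n + 1) := by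
  unfold width; rw [pow_succ 3 (n + 1)]; field_simp

theorem height_pos (n : ℕ) : 0 < height n := by cases n <;> simp [height]

theorem height_mul_width (n : ℕ) : (height n : ℝ) * width n = 1 - width n / 2 := by
  induction n with
  | zero => norm_num [height, width]
  | succ n ih =>
    have := width_succ n
    simp only [height]; push_cast
    nlinarith

theorem exists_width_lt {e : ℝ} (he : 0 < e) (m : ℕ) : ∃ n, m ≤ n ∧ width n < e := by
  have h : Tendsto (fun n : ℕ => 2 / 3 * (1 / 3 : ℝ) ^ n) atTop (𝓝 0) := by
    simpa using (tendsto_pow_atTop_nhds_zero_of_lt_one (r := (1 / 3 : ℝ))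
      (by norm_num) (by norm_num)).const_mul (2 / 3)
  obtain ⟨n, hn, hn'⟩ := ((h.eventually (gt_mem_nhds he)).and (eventually_ge_atTop m)).exists
  refine ⟨n, hn', ?_⟩
  have : width n = 2 / 3 * (1 / 3 : ℝ) ^ n := by
    unfold width; rw [pow_succ, one_div, inv_pow]; field_simp
  rwa [this]

theorem left_first {n j : ℕ} (h : j < height n) : left (n + 1) j = left n j := by
  simp [left, h]

theorem left_second {n j : ℕ} (h : j < height n) :
    left (n + 1) (j + height n) = left n j + width (n + 1) := by
  have h2 : j + height n < 2 * height n := by omega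
  simp [left, h2]

theorem left_spacer (n : ℕ) : left (n + 1) (2 * height n) = height n * width n := by
  have h1 : ¬ 2 * height n < height n := by omega
  simp [left, h1]

theorem left_third (n j : ℕ) :
    left (n + 1) (j + (2 * height n + 1)) = left n j + 2 * width (n + 1) := by
  have h1 : ¬ j + (2 * height n + 1) < height n := by omega
  have h2 : ¬ j + (2 * height n + 1) < 2 * height n := by omega
  have h3 : ¬ j + (2 * height n + 1) = 2 * height n := by omega
  simp [left, h1, h2, h3]

theorem cases_succ {n j : ℕ} (h : j < height (n + 1)) :
    j < height n ∨ (∃ i < height n, j = i + height n) ∨ j = 2 * height n ∨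
      ∃ i < height n, j = i + (2 * height n + 1) := by
  simp only [height] at h
  by_cases h1 : j < height n
  · exact Or.inl h1
  by_cases h2 : j < 2 * height n
  · exact Or.inr (Or.inl ⟨j - height n, by omega, by omega⟩)
  by_cases h3 : j = 2 * height n
  · exact Or.inr (Or.inr (Or.inl h3))
  · exact Or.inr (Or.inr (Or.inr ⟨j - (2 * height n + 1), by omega, by omega⟩))

/-- The levels of the tower of stage `n` lie in `[0, height n * width n)`. -/
theorem left_bounds {n j : ℕ} (h : j < height n) :
    0 ≤ left n j ∧ left n j + width n ≤ height n * width n := by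
  induction n generalizing j with
  | zero => simp [left, height]
  | succ n ih =>
    have hw := width_pos (n + 1)
    have hs := width_succ n
    have e1 := height_mul_width n
    have e2 := height_mul_width (n + 1)
    rcases cases_succ h with h | ⟨i, hi, rfl⟩ | rfl | ⟨i, hi, rfl⟩
    · have := ih h
      rw [left_first h]; constructor <;> linarith
    · have := ih hi
      rw [left_second hi]; constructor <;> linarith
    · rw [left_spacer]
      constructor
      · have := width_pos n; positivity
      · linarith
    · have := ih hi
      rw [left_third]; constructor <;> linarith

/-- The levels of the tower of stage `n` are pairwise disjoint. -/
theorem level_unique {n i j : ℕ} (hi : i < height n) (hj : j < height n) {x : ℝ}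
    (hxi : x ∈ level n i) (hxj : x ∈ level n j) : i = j := by
  induction n generalizing i j with
  | zero => simp only [height] at hi hj; omega
  | succ n ih =>
    have hw := width_pos (n + 1)
    have hs := width_succ n
    obtain ⟨a1, a2⟩ := hxi
    obtain ⟨b1, b2⟩ := hxj
    rcases cases_succ hi with hi' | ⟨i', hi', rfl⟩ | rfl | ⟨i', hi', rfl⟩ <;>
    rcases cases_succ hj with hj' | ⟨j', hj', rfl⟩ | rfl | ⟨j', hj', rfl⟩ <;>
    (try have hib := (left_bounds hi').2) <;>
    (try have hjb := (left_bounds hj').2) <;>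
    (try rw [left_first hi'] at a1 a2) <;>
    (try rw [left_second hi'] at a1 a2) <;>
    (try rw [left_third] at a1 a2) <;>
    (try rw [left_spacer] at a1 a2) <;>
    (try rw [left_first hj'] at b1 b2) <;>
    (try rw [left_second hj'] at b1 b2) <;>
    (try rw [left_third] at b1 b2) <;>
    (try rw [left_spacer] at b1 b2) <;>
    first
    | rfl
    | (exfalso; linarith)
    | (have hij := ih hi' hj' ⟨by linarith, by linarith⟩ ⟨by linarith, by linarith⟩
       subst hij
       first
       | rfl
       | (exfalso; linarith))

/-- A point of level `j` of stage `n` lies in one of the three levels of stage `n + 1` into which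
level `j` is cut. -/
theorem level_refine {n j : ℕ} (hj : j < height n) {x : ℝ} (hx : x ∈ level n j) :
    x ∈ level (n + 1) j ∨ x ∈ level (n + 1) (j + height n) ∨
      x ∈ level (n + 1) (j + (2 * height n + 1)) := by
  obtain ⟨h1, h2⟩ := hx
  have hs := width_succ n
  unfold level
  rw [left_first hj, left_second hj, left_third]
  by_cases c1 : x < left n j + width (n + 1)
  · exact Or.inl ⟨h1, c1⟩
  by_cases c2 : x < left n j + 2 * width (n + 1)
  · exact Or.inr (Or.inl ⟨by linarith, by linarith⟩)
  · exact Or.inr (Or.inr ⟨by linarith, by linarith⟩)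

theorem Step.succ {n : ℕ} {x y : ℝ} (h : Step n x y) : Step (n + 1) x y := by
  obtain ⟨j, hj, hx, rfl⟩ := h
  have hj0 : j < height n := by omega
  have hh : height (n + 1) = 3 * height n + 1 := rfl
  rcases level_refine hj0 hx with h | h | h
  · refine ⟨j, by omega, h, ?_⟩
    rw [left_first hj0, left_first hj]
  · refine ⟨j + height n, by omega, h, ?_⟩
    have e : j + height n + 1 = (j + 1) + height n := by ring
    rw [e, left_second hj0, left_second hj]; ring
  · refine ⟨j + (2 * height n + 1), by omega, h, ?_⟩
    have e : j + (2 * height n + 1) + 1 = (j + 1) + (2 * height n + 1) := by ring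
    rw [e, left_third, left_third]; ring

theorem Step.mono {m n : ℕ} (hmn : m ≤ n) {x y : ℝ} (h : Step m x y) : Step n x y := by
  induction hmn with
  | refl => exact h
  | step _ ih => exact ih.succ

theorem height_mono {m n : ℕ} (hmn : m ≤ n) : height m ≤ height n := by
  induction hmn with
  | refl => exact le_rfl
  | step _ ih => simp only [height]; omega

theorem left_mono {m n j : ℕ} (hmn : m ≤ n) (hj : j < height m) : left n j = left m j := by
  induction hmn with
  | refl => rfl
  | step h ih => rw [left_first (hj.trans_le (height_mono h)), ih]

/-- The tower of stage `n` fills `[0, height n * width n)`. -/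
theorem exists_level (n : ℕ) {x : ℝ} (h0 : 0 ≤ x) (h1 : x < height n * width n) :
    ∃ j < height n, x ∈ level n j := by
  induction n with
  | zero => exact ⟨0, by simp [height], by simp [level, left, height] at *; exact ⟨h0, h1⟩⟩
  | succ n ih =>
    have hh : height (n + 1) = 3 * height n + 1 := rfl
    by_cases h : x < height n * width n
    · obtain ⟨j, hj, hx⟩ := ih h
      rcases level_refine hj hx with h | h | h
      · exact ⟨_, by omega, h⟩
      · exact ⟨_, by omega, h⟩
      · exact ⟨_, by omega, h⟩
    · refine ⟨2 * height n, by omega, ?_⟩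
      have e1 := height_mul_width n
      have e2 := height_mul_width (n + 1)
      have hs := width_succ n
      unfold level
      rw [left_spacer]
      exact ⟨by linarith, by linarith⟩

theorem exists_level_of_lt_one {x : ℝ} (h0 : 0 ≤ x) (h1 : x < 1) :
    ∃ m, ∀ n, m ≤ n → ∃ j < height n, x ∈ level n j := by
  obtain ⟨m, -, hm⟩ := exists_width_lt (sub_pos.2 h1) 0
  refine ⟨m, fun n hn => exists_level n h0 ?_⟩
  have hle : width n ≤ width m := by
    unfold width
    gcongr
    norm_num
  have := height_mul_width n
  have := width_pos n
  linarith

/-- The right endpoint of the top level does not depend on the stage. -/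
theorem left_top (n : ℕ) : left n (height n - 1) + width n = 2 / 3 := by
  induction n with
  | zero => norm_num [left, height, width]
  | succ n ih =>
    have hp := height_pos n
    have e : height (n + 1) - 1 = (height n - 1) + (2 * height n + 1) := by
      simp only [height]; omega
    have hs := width_succ n
    rw [e, left_third]
    linarith

theorem left_zero (n : ℕ) : left n 0 = 0 := by
  rw [left_mono (Nat.zero_le n) (by simp [height])]; rfl

/-- Every point of `[0, 1)` has an image. -/
theorem exists_step {x : ℝ} (h0 : 0 ≤ x) (h1 : x < 1) : ∃ n y, Step n x y := by
  obtain ⟨m, hm⟩ := exists_level_of_lt_one h0 h1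
  by_contra! hcon
  have key : ∀ n, m ≤ n → x ∈ level n (height n - 1) := by
    intro n hn
    obtain ⟨j, hj, hx⟩ := hm n hn
    have : ¬ j + 1 < height n := fun h => hcon n _ ⟨j, h, hx, rfl⟩
    have e : height n - 1 = j := by omega
    rwa [e]
  have hx : x < 2 / 3 := by
    have := (key m le_rfl).2
    rwa [left_top] at this
  obtain ⟨n, hn, hw⟩ := exists_width_lt (sub_pos.2 hx) m
  have h2 := (key n hn).1
  have h3 := left_top n
  linarith

/-- Every point of `(0, 1)` has a preimage. -/
theorem exists_step_to {y : ℝ} (h0 : 0 < y) (h1 : y < 1) : ∃ n x, Step n x y := by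
  obtain ⟨m, hm⟩ := exists_level_of_lt_one h0.le h1
  obtain ⟨n, hn, hw⟩ := exists_width_lt h0 m
  obtain ⟨j, hj, hx⟩ := hm n hn
  cases j with
  | zero =>
    have := hx.2
    rw [left_zero] at this
    linarith
  | succ j =>
    refine ⟨n, y - left n (j + 1) + left n j, j, hj, ?_, by ring⟩
    obtain ⟨a, b⟩ := hx
    exact ⟨by linarith, by linarith⟩

theorem Step.target_mem {n j : ℕ} {x : ℝ} (hx : x ∈ level n j) :
    x - left n j + left n (j + 1) ∈ level n (j + 1) :=
  ⟨by linarith [hx.1], by linarith [hx.2]⟩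

theorem Step.right_unique {m n : ℕ} {x y z : ℝ} (h : Step m x y) (h' : Step n x z) : y = z := by
  obtain ⟨i, hi, hx, rfl⟩ := h.mono (le_max_left m n)
  obtain ⟨j, hj, hx', rfl⟩ := h'.mono (le_max_right m n)
  obtain rfl := level_unique (by omega) (by omega) hx hx'
  rfl

theorem Step.left_unique {m n : ℕ} {x y z : ℝ} (h : Step m x z) (h' : Step n y z) : x = y := by
  obtain ⟨i, hi, hx, hz⟩ := h.mono (le_max_left m n)
  obtain ⟨j, hj, hy, hz'⟩ := h'.mono (le_max_right m n)
  have e := level_unique hi hj (hz ▸ Step.target_mem hx) (hz' ▸ Step.target_mem hy)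
  obtain rfl : i = j := by omega
  linarith

/-- A point and its image both lie in the phase space or both lie outside it. -/
theorem Step.mem_iff {n : ℕ} {x y : ℝ} (h : Step n x y) : x ∈ space ↔ y ∈ space := by
  have hunit : ∀ {n j : ℕ} {z : ℝ}, j < height n → z ∈ level n j → z ∈ Set.Ico (0 : ℝ) 1 := by
    intro n j z hj hz
    have h1 := left_bounds hj
    have h2 := height_mul_width n
    have h3 := width_pos n
    exact ⟨by linarith [hz.1], by linarith [hz.2]⟩
  constructor
  · intro hx
    refine ⟨?_, ?_⟩
    · obtain ⟨j, hj, hxj, rfl⟩ := h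
      exact hunit hj (Step.target_mem hxj)
    · intro m i hi hy
      obtain ⟨j, hj, hxj, hyj⟩ := h.mono (le_max_left n m)
      have hi' : i < height (max n m) := hi.trans_le (height_mono (le_max_right n m))
      rw [← left_mono (le_max_right n m) hi] at hy
      have hw := width_pos (max n m)
      have hyl : y ∈ level (max n m) i := ⟨hy.ge, by linarith⟩
      have e := level_unique hj hi' (hyj ▸ Step.target_mem hxj) hyl
      subst e
      exact hx.2 (max n m) j (by omega) (by linarith)
  · intro hy
    refine ⟨?_, ?_⟩
    · obtain ⟨j, hj, hxj, rfl⟩ := h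
      exact hunit (by omega) hxj
    · intro m i hi hx
      obtain ⟨j, hj, hxj, hyj⟩ := h.mono (le_max_left n m)
      have hi' : i < height (max n m) := hi.trans_le (height_mono (le_max_right n m))
      rw [← left_mono (le_max_right n m) hi] at hx
      have hw := width_pos (max n m)
      have hxl : x ∈ level (max n m) i := ⟨hx.ge, by linarith⟩
      have e := level_unique (by omega) hi' hxj hxl
      subst e
      exact hy.2 (max n m) (j + 1) hj (by linarith)

theorem exists_image (x : space) : ∃ y : space, ∃ n, Step n (x : ℝ) (y : ℝ) := by
  obtain ⟨n, y, h⟩ := exists_step x.2.1.1 x.2.1.2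
  exact ⟨⟨y, h.mem_iff.1 x.2⟩, n, h⟩

/-- The image of a point: its translate to the level above it, at any stage at which the point
lies in a level that is not the top one. -/
def mapFun (x : space) : space := (exists_image x).choose

theorem mapFun_spec (x : space) : ∃ n, Step n (x : ℝ) (mapFun x : ℝ) := (exists_image x).choose_spec

theorem mapFun_bijective : Function.Bijective mapFun := by
  constructor
  · intro x y hxy
    obtain ⟨m, hm⟩ := mapFun_spec x
    obtain ⟨n, hn⟩ := mapFun_spec y
    rw [hxy] at hm
    exact Subtype.ext (hm.left_unique hn)
  · intro y
    have h0 : (0 : ℝ) < y := by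
      refine lt_of_le_of_ne y.2.1.1 fun h => y.2.2 0 0 (by simp [height]) ?_
      rw [left_zero, ← h]
    obtain ⟨n, x, h⟩ := exists_step_to h0 y.2.1.2
    refine ⟨⟨x, h.mem_iff.2 y.2⟩, ?_⟩
    obtain ⟨m, hm⟩ := mapFun_spec ⟨x, h.mem_iff.2 y.2⟩
    exact Subtype.ext (hm.right_unique h)

/-- Chacon's map, as a bijection of the phase space. -/
def chaconMap : Equiv.Perm space := Equiv.ofBijective mapFun mapFun_bijective

/-- The invariant measure of Chacon's map: Lebesgue measure on the phase space. -/
def chaconMeasure : Measure space := (volume : Measure ℝ).comap Subtype.val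

/-- The product of Chacon's map with itself, as an action of `ℤ^2`:
`(v₁, v₂)` sends `(x, y)` to `(T ^ v₁ x, T ^ v₂ y)`. -/
instance chaconProductAction : AddAction (Fin 2 → ℤ) (space × space) where
  vadd v p := ((chaconMap ^ v 0) p.1, (chaconMap ^ v 1) p.2)
  zero_vadd p := by
    change ((chaconMap ^ (0 : ℤ)) p.1, (chaconMap ^ (0 : ℤ)) p.2) = p
    simp
  add_vadd v w p := by
    change ((chaconMap ^ (v 0 + w 0)) p.1, (chaconMap ^ (v 1 + w 1)) p.2) =
      ((chaconMap ^ v 0) ((chaconMap ^ w 0) p.1), (chaconMap ^ v 1) ((chaconMap ^ w 1) p.2))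
    simp [zpow_add]

/-- The product measure on the phase space of the product action. -/
def chaconProductMeasure : Measure (space × space) := chaconMeasure.prod chaconMeasure

end Chacon

end

/-!
Chacon's map moves the levels of each tower by translations, so it preserves the measure up to an
error which is the measure of the top level and of the unused spacers, and this tends to zero. The
product of two towers of stage `n` is a tower over the square `base n` with shape
`{0, …, height n - 1}²`. These shapes form a Følner sequence (`isFolnerSequence_box`), and the
action is rank one for them because the levels have small diameter and cover almost everything:
inside a measurable set take a closed set of almost the same measure, and keep the levels that
meet it (`eventually_exists_symmDiff_le`). The action is not totally ergodic, since `(1, 0)` does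
not move the second coordinate.

There is no finite odometer factor by Chacon's own use of the spacer. A factor map gives an
equivariant `f` with values in a finite quotient `ℤ² / G`. Some fibre `f = q` has positive measure
and so fills almost all of some level of a product tower (`exists_vadd_base_diff_lt`). In either
coordinate, a third of that level returns to it after `height n` steps, and also after
`2 * height n + 1` steps (`exists_third_of_base`). As `f` is almost constant on the level, some
point and both its translates lie in the fibre, so `G` contains `height n • e` and
`(2 * height n + 1) • e`, hence the unit vector `e` (`single_one_mem_of_equivariant`). Thus
`G = ℤ²`.
-/

namespace Chacon

/-! ### The phase space and its measure -/

theorem measurableSet_level (n j : ℕ) : MeasurableSet (level n j) := measurableSet_Ico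

theorem countable_setOf_left : {x : ℝ | ∃ n j, j < height n ∧ x = left n j}.Countable := by
  refine (Set.countable_range fun p : ℕ × ℕ => left p.1 p.2).mono ?_
  rintro x ⟨n, j, -, rfl⟩
  exact ⟨(n, j), rfl⟩

theorem space_eq_diff :
    space = Set.Ico (0 : ℝ) 1 \ {x : ℝ | ∃ n j, j < height n ∧ x = left n j} := by
  ext x
  simp only [space, Set.mem_ofPred_eq, Set.mem_sdiff, not_exists, not_and]

theorem measurableSet_space : MeasurableSet space := by
  rw [space_eq_diff]
  exact measurableSet_Ico.diff countable_setOf_left.measurableSet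

instance : StandardBorelSpace space := measurableSet_space.standardBorel

theorem chaconMeasure_apply (s : Set space) : chaconMeasure s = volume (Subtype.val '' s) :=
  (MeasurableEmbedding.subtype_coe measurableSet_space).comap_apply _ _

/-- The removed endpoints form a null set. -/
theorem chaconMeasure_preimage {s : Set ℝ} (hs : s ⊆ Set.Ico 0 1) :
    chaconMeasure (Subtype.val ⁻¹' s) = volume s := by
  rw [chaconMeasure_apply, Subtype.image_preimage_coe, Set.inter_comm]
  have : s ∩ space = s \ {x : ℝ | ∃ n j, j < height n ∧ x = left n j} := by
    rw [space_eq_diff, ← Set.inter_sdiff_assoc, Set.inter_eq_left.2 hs]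
  rw [this, measure_sdiff_null (countable_setOf_left.measure_zero _)]

instance : IsProbabilityMeasure chaconMeasure := by
  constructor
  have h := chaconMeasure_preimage (s := Set.Ico 0 1) subset_rfl
  have e : (Subtype.val ⁻¹' Set.Ico 0 1 : Set space) = Set.univ :=
    Set.eq_univ_of_forall fun x => x.2.1
  rw [e] at h
  simp [h]

theorem chaconMeasure_singleton (x : space) : chaconMeasure {x} = 0 := by
  simp [chaconMeasure_apply]

/-- The part of level `j` of stage `n` that lies in the phase space. -/
def levelSet (n j : ℕ) : Set space := Subtype.val ⁻¹' level n j

theorem measurableSet_levelSet (n j : ℕ) : MeasurableSet (levelSet n j) :=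
  measurable_subtype_coe (measurableSet_level n j)

theorem chaconMeasure_levelSet {n j : ℕ} (hj : j < height n) :
    chaconMeasure (levelSet n j) = ENNReal.ofReal (width n) := by
  have h1 := left_bounds hj
  have h2 := height_mul_width n
  have h3 := width_pos n
  rw [levelSet, chaconMeasure_preimage, level, Real.volume_Ico]
  · congr 1; ring
  · rintro x ⟨a, b⟩
    exact ⟨by linarith, by linarith⟩

/-- The part of the phase space covered by the tower of stage `n`. -/
def towerSet (n : ℕ) : Set space := {x | (x : ℝ) < height n * width n}

theorem exists_mem_levelSet {n : ℕ} {x : space} (hx : x ∈ towerSet n) :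
    ∃ j < height n, x ∈ levelSet n j :=
  exists_level n x.2.1.1 hx

theorem chaconMeasure_compl_towerSet (n : ℕ) :
    chaconMeasure (towerSet n)ᶜ = ENNReal.ofReal (width n / 2) := by
  have h2 := height_mul_width n
  have h3 := width_pos n
  have e : (towerSet n)ᶜ = Subtype.val ⁻¹' Set.Ico (height n * width n) 1 := by
    ext x
    simp only [towerSet, Set.mem_compl_iff, Set.mem_ofPred_eq, not_lt, Set.mem_preimage,
      Set.mem_Ico]
    exact ⟨fun h => ⟨h, x.2.1.2⟩, fun h => h.1⟩
  rw [e, chaconMeasure_preimage, Real.volume_Ico, h2]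
  · congr 1; ring
  · exact Set.Ico_subset_Ico_left (by have := (height n).cast_nonneg (α := ℝ); positivity)

theorem tendsto_width : Tendsto width atTop (𝓝 0) := by
  have h : Tendsto (fun n : ℕ => 2 / 3 * (1 / 3 : ℝ) ^ n) atTop (𝓝 0) := by
    simpa using (tendsto_pow_atTop_nhds_zero_of_lt_one (r := (1 / 3 : ℝ))
      (by norm_num) (by norm_num)).const_mul (2 / 3)
  refine h.congr fun n => ?_
  unfold width
  rw [pow_succ, one_div, inv_pow]
  field_simp

theorem lt_height (n : ℕ) : n < height n := by
  induction n with
  | zero => simp [height]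
  | succ n ih => simp only [height]; omega

theorem tendsto_height : Tendsto height atTop atTop :=
  tendsto_atTop_mono (fun n => (lt_height n).le) tendsto_id

/-! ### Chacon's map on levels, and invariance of the measure -/

theorem chaconMap_apply_eq {n : ℕ} {x : space} {y : ℝ} (h : Step n x y) :
    (chaconMap x : ℝ) = y := by
  obtain ⟨m, hm⟩ := mapFun_spec x
  exact hm.right_unique h

theorem coe_chaconMap {n j : ℕ} (hj : j + 1 < height n) {x : space} (hx : x ∈ levelSet n j) :
    (chaconMap x : ℝ) = x - left n j + left n (j + 1) :=
  chaconMap_apply_eq ⟨j, hj, hx, rfl⟩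

theorem chaconMap_mem_levelSet_succ {n j : ℕ} (hj : j + 1 < height n) {x : space} :
    chaconMap x ∈ levelSet n (j + 1) ↔ x ∈ levelSet n j := by
  constructor
  · intro h
    obtain ⟨m, hm⟩ := mapFun_spec x
    have h' : Step n (mapFun x - left n (j + 1) + left n j) (mapFun x) := by
      refine ⟨j, hj, ⟨?_, ?_⟩, by ring⟩
      · linarith [h.1, show (chaconMap x : ℝ) = mapFun x from rfl]
      · linarith [h.2, show (chaconMap x : ℝ) = mapFun x from rfl]
    have e := hm.left_unique h'
    refine ⟨?_, ?_⟩ <;> rw [e]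
    · linarith [h.1, show (chaconMap x : ℝ) = mapFun x from rfl]
    · linarith [h.2, show (chaconMap x : ℝ) = mapFun x from rfl]
  · intro h
    rw [levelSet, Set.mem_preimage, coe_chaconMap hj h]
    exact Step.target_mem h

theorem chaconMap_pow_mem_levelSet {n j : ℕ} (hj : j < height n) {x : space} :
    (chaconMap ^ j) x ∈ levelSet n j ↔ x ∈ levelSet n 0 := by
  induction j with
  | zero => simp
  | succ j ih =>
    rw [pow_succ', Equiv.Perm.mul_apply, chaconMap_mem_levelSet_succ hj, ih (by omega)]

theorem measurable_chaconMap : Measurable chaconMap := by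
  intro s hs
  obtain ⟨t, ht, rfl⟩ := hs
  have e : chaconMap ⁻¹' (Subtype.val ⁻¹' t) = ⋃ (n : ℕ) (j : ℕ) (_ : j + 1 < height n),
      levelSet n j ∩ {x | (x : ℝ) - left n j + left n (j + 1) ∈ t} := by
    ext x
    simp only [Set.mem_preimage, Set.mem_iUnion, Set.mem_inter_iff, Set.mem_ofPred_eq]
    constructor
    · intro h
      obtain ⟨n, j, hj, hx, e⟩ := mapFun_spec x
      refine ⟨n, j, hj, hx, ?_⟩
      rw [← e]; exact h
    · rintro ⟨n, j, hj, hx, h⟩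
      rwa [coe_chaconMap hj hx]
  rw [e]
  refine MeasurableSet.iUnion fun n => .iUnion fun j => .iUnion fun _ =>
    (measurableSet_levelSet n j).inter ?_
  exact ((measurable_subtype_coe.sub_const _).add_const _) ht

/-- On a level that is not the top one, the map is a translation. -/
theorem chaconMeasure_levelSet_inter_preimage {n j : ℕ} (hj : j + 1 < height n) (s : Set space) :
    chaconMeasure (levelSet n j ∩ chaconMap ⁻¹' s) =
      chaconMeasure (levelSet n (j + 1) ∩ s) := by
  rw [chaconMeasure_apply, chaconMeasure_apply,
    ← measure_preimage_add volume (left n j - left n (j + 1)) (Subtype.val '' _)]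
  congr 1
  ext y
  simp only [Set.mem_image, Set.mem_preimage, Set.mem_inter_iff]
  constructor
  · rintro ⟨x, ⟨hx, hxs⟩, e⟩
    refine ⟨chaconMap x, ⟨(chaconMap_mem_levelSet_succ hj).2 hx, hxs⟩, ?_⟩
    rw [coe_chaconMap hj hx, e]; ring
  · rintro ⟨z, ⟨hz, hzs⟩, rfl⟩
    obtain ⟨x, rfl⟩ := chaconMap.surjective z
    have hx := (chaconMap_mem_levelSet_succ hj).1 hz
    refine ⟨x, ⟨hx, hzs⟩, ?_⟩
    rw [coe_chaconMap hj hx]; ring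

/-- Summing over the levels of a high tower shows that taking preimages does not increase the
measure, up to the small measure of the top level and of the reservoir of spacers. -/
theorem chaconMeasure_preimage_le {s : Set space} (hs : MeasurableSet s) :
    chaconMeasure (chaconMap ⁻¹' s) ≤ chaconMeasure s := by
  have key (n : ℕ) : chaconMeasure (chaconMap ⁻¹' s) ≤
      chaconMeasure s + (ENNReal.ofReal (width n) + ENNReal.ofReal (width n / 2)) := by
    have hp := height_pos n
    have hsub : chaconMap ⁻¹' s ⊆
        (⋃ j ∈ Finset.range (height n - 1), levelSet n j ∩ chaconMap ⁻¹' s) ∪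
          (levelSet n (height n - 1) ∪ (towerSet n)ᶜ) := by
      intro x hx
      by_cases ht : x ∈ towerSet n
      · obtain ⟨j, hj, hxj⟩ := exists_mem_levelSet ht
        by_cases h : j < height n - 1
        · left
          simp only [Set.mem_iUnion, Finset.mem_range]
          exact ⟨j, h, hxj, hx⟩
        · obtain rfl : j = height n - 1 := by omega
          exact Or.inr (Or.inl hxj)
      · exact Or.inr (Or.inr ht)
    have hsum : chaconMeasure (⋃ j ∈ Finset.range (height n - 1),
        levelSet n j ∩ chaconMap ⁻¹' s) ≤ chaconMeasure s := by
      refine (measure_biUnion_finset_le _ _).trans ?_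
      rw [Finset.sum_congr rfl fun j hj => chaconMeasure_levelSet_inter_preimage
        (show j + 1 < height n by have := Finset.mem_range.1 hj; omega) s,
        ← measure_biUnion_finset]
      · exact measure_mono (Set.iUnion₂_subset fun _ _ => Set.inter_subset_right)
      · intro i hi j hj hij
        have hi' := Finset.mem_range.1 hi
        have hj' := Finset.mem_range.1 hj
        refine Set.disjoint_left.2 fun x hx hx' => hij ?_
        have := level_unique (by omega) (by omega) hx.1 hx'.1
        omega
      · exact fun j _ => (measurableSet_levelSet n _).inter hs
    calc chaconMeasure (chaconMap ⁻¹' s) ≤ _ := measure_mono hsub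
      _ ≤ _ := measure_union_le _ _
      _ ≤ _ := add_le_add hsum (measure_union_le _ _)
      _ = _ := by rw [chaconMeasure_levelSet (by omega), chaconMeasure_compl_towerSet]
  have hlim : Tendsto (fun n => chaconMeasure s +
      (ENNReal.ofReal (width n) + ENNReal.ofReal (width n / 2))) atTop (𝓝 (chaconMeasure s)) := by
    have h1 := ENNReal.tendsto_ofReal tendsto_width
    have h2 := ENNReal.tendsto_ofReal (tendsto_width.div_const 2)
    simpa using (h1.add h2).const_add (chaconMeasure s)
  exact ge_of_tendsto' hlim key

/-- Chacon's map preserves the measure: apply `chaconMeasure_preimage_le` to a set and to its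
complement. -/
theorem measurePreserving_chaconMap : MeasurePreserving chaconMap chaconMeasure chaconMeasure := by
  refine ⟨measurable_chaconMap, Measure.ext fun s hs => ?_⟩
  rw [Measure.map_apply measurable_chaconMap hs]
  refine le_antisymm (chaconMeasure_preimage_le hs) ?_
  have h := chaconMeasure_preimage_le hs.compl
  rw [Set.preimage_compl, prob_compl_eq_one_sub (measurable_chaconMap hs),
    prob_compl_eq_one_sub hs] at h
  exact (ENNReal.sub_le_sub_iff_left prob_le_one ENNReal.one_ne_top).1 h

theorem measurePreserving_chaconMap_zpow (k : ℤ) :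
    MeasurePreserving (chaconMap ^ k : Equiv.Perm space) chaconMeasure chaconMeasure := by
  have hpow (m : ℕ) :
      MeasurePreserving (chaconMap ^ m : Equiv.Perm space) chaconMeasure chaconMeasure := by
    rw [← Equiv.Perm.iterate_eq_pow]
    exact measurePreserving_chaconMap.iterate m
  obtain ⟨m, rfl | rfl⟩ := k.eq_nat_or_neg
  · simpa using hpow m
  · -- A measurable bijection of a standard Borel space has a measurable inverse.
    have hemb := (hpow m).measurable.measurableEmbedding (chaconMap ^ m).injective
    let e : space ≃ᵐ space :=
      { toEquiv := chaconMap ^ m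
        measurable_toFun := (hpow m).measurable
        measurable_invFun := fun s hs => by
          have := hemb.measurableSet_image.2 hs
          rwa [Equiv.image_eq_preimage_symm] at this }
    have h := MeasurePreserving.symm e (hpow m)
    rw [zpow_neg, zpow_natCast]
    exact h

/-! ### The product action -/

theorem vadd_def (v : Fin 2 → ℤ) (p : space × space) :
    v +ᵥ p = ((chaconMap ^ v 0) p.1, (chaconMap ^ v 1) p.2) := rfl

instance : IsProbabilityMeasure chaconProductMeasure := by
  unfold chaconProductMeasure; infer_instance

theorem isLebesgueProbabilitySpace_chaconProductMeasure :
    RankOne.IsLebesgueProbabilitySpace (space × space) chaconProductMeasure where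
  standardBorel := inferInstance
  isProbabilityMeasure := inferInstance
  nonatomic := fun ⟨x, y⟩ => by
    rw [← Set.singleton_prod_singleton, chaconProductMeasure, Measure.prod_prod,
      chaconMeasure_singleton, zero_mul]

instance : MeasurableConstVAdd (Fin 2 → ℤ) (space × space) where
  measurable_const_vadd v := ((measurePreserving_chaconMap_zpow (v 0)).measurable.prodMap
    (measurePreserving_chaconMap_zpow (v 1)).measurable)

instance : VAddInvariantMeasure (Fin 2 → ℤ) (space × space) chaconProductMeasure where
  measure_preimage_vadd v _ hs :=
    ((measurePreserving_chaconMap_zpow (v 0)).prod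
      (measurePreserving_chaconMap_zpow (v 1))).measure_preimage hs.nullMeasurableSet

theorem isMeasurePreservingAction_chaconProductMeasure :
    RankOne.IsMeasurePreservingAction (Fin 2 → ℤ) chaconProductMeasure := fun v =>
  measurePreserving_vadd v _

/-- The vector `(1, 0)` moves only the first coordinate, so it leaves the sets
`univ ×ˢ s` invariant. -/
theorem not_isTotallyErgodic_chaconProductMeasure :
    ¬ RankOne.IsTotallyErgodic (Fin 2 → ℤ) chaconProductMeasure := by
  intro h
  have hv : (![1, 0] : Fin 2 → ℤ) ≠ 0 := fun e => by simpa using congrFun e 0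
  have hm : MeasurableSet (Set.univ ×ˢ levelSet 0 0 : Set (space × space)) :=
    MeasurableSet.univ.prod (measurableSet_levelSet 0 0)
  have hμ : chaconProductMeasure (Set.univ ×ˢ levelSet 0 0) = ENNReal.ofReal (2 / 3) := by
    rw [chaconProductMeasure, Measure.prod_prod, chaconMeasure_levelSet (height_pos 0)]
    simp [width]
  have hinv : (fun p : space × space => (![1, 0] : Fin 2 → ℤ) +ᵥ p) ⁻¹'
      (Set.univ ×ˢ levelSet 0 0) = Set.univ ×ˢ levelSet 0 0 := by
    ext p
    simp [vadd_def]
  rcases (h _ hv).toPreErgodic.prob_eq_zero_or_one hm hinv with h0 | h1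
  · rw [hμ, ENNReal.ofReal_eq_zero] at h0
    norm_num at h0
  · rw [hμ, ENNReal.ofReal_eq_one] at h1
    norm_num at h1

/-! ### Rank one -/

/-- The square `{0, …, height n - 1}²`, the shape of the product of two towers of stage `n`. -/
noncomputable def box (n : ℕ) : Finset (Fin 2 → ℤ) :=
  Fintype.piFinset fun _ => Finset.Ico 0 (height n : ℤ)

/-- The product of two bottom levels of stage `n`. -/
def base (n : ℕ) : Set (space × space) := levelSet n 0 ×ˢ levelSet n 0

theorem mem_box {n : ℕ} {v : Fin 2 → ℤ} : v ∈ box n ↔ ∀ i, 0 ≤ v i ∧ v i < height n := by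
  simp [box]

theorem box_nonempty (n : ℕ) : (box n).Nonempty :=
  ⟨0, mem_box.2 fun _ => ⟨le_rfl, Int.natCast_pos.2 (height_pos n)⟩⟩

theorem card_box (n : ℕ) : (box n).card = height n ^ 2 := by
  simp [box]

theorem measurableSet_base (n : ℕ) : MeasurableSet (base n) :=
  (measurableSet_levelSet n 0).prod (measurableSet_levelSet n 0)

theorem mem_vadd_base {n : ℕ} {v : Fin 2 → ℤ} (hv : v ∈ box n) {p : space × space} :
    p ∈ v +ᵥ base n ↔ p.1 ∈ levelSet n (v 0).toNat ∧ p.2 ∈ levelSet n (v 1).toNat := by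
  have key (i : Fin 2) (x : space) :
      (chaconMap ^ (v i)) x ∈ levelSet n (v i).toNat ↔ x ∈ levelSet n 0 := by
    have h := mem_box.1 hv i
    conv_lhs => enter [2, 1]; rw [← Int.toNat_of_nonneg h.1, zpow_natCast]
    exact chaconMap_pow_mem_levelSet (by omega)
  constructor
  · rintro ⟨q, hq, rfl⟩
    exact ⟨(key 0 _).2 hq.1, (key 1 _).2 hq.2⟩
  · intro h
    obtain ⟨q, rfl⟩ : ∃ q, v +ᵥ q = p := ⟨-v +ᵥ p, by simp⟩
    exact ⟨q, ⟨(key 0 _).1 h.1, (key 1 _).1 h.2⟩, rfl⟩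

theorem exists_mem_vadd_base {n : ℕ} {p : space × space} (h1 : p.1 ∈ towerSet n)
    (h2 : p.2 ∈ towerSet n) : ∃ v ∈ box n, p ∈ v +ᵥ base n := by
  obtain ⟨i, hi, hi'⟩ := exists_mem_levelSet h1
  obtain ⟨j, hj, hj'⟩ := exists_mem_levelSet h2
  have hv : (![(i : ℤ), j] : Fin 2 → ℤ) ∈ box n := by
    simp [mem_box, Fin.forall_fin_two, hi, hj]
  exact ⟨_, hv, (mem_vadd_base hv).2 ⟨hi', hj'⟩⟩

theorem isTowerBase_base (n : ℕ) :
    RankOne.IsTowerBase chaconProductMeasure (box n) (base n) where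
  measurableSet := measurableSet_base n
  pos := by
    rw [base, chaconProductMeasure, Measure.prod_prod, chaconMeasure_levelSet (height_pos n)]
    have := ENNReal.ofReal_pos.2 (width_pos n)
    exact ENNReal.mul_pos this.ne' this.ne'
  disjoint := by
    intro v hv w hw hvw
    refine Set.disjoint_left.2 fun p hp hp' => hvw ?_
    have h1 := (mem_vadd_base hv).1 hp
    have h2 := (mem_vadd_base hw).1 hp'
    have hv' := mem_box.1 hv
    have hw' := mem_box.1 hw
    funext i
    have := hv' i
    have := hw' i
    fin_cases i
    · have := level_unique (by simp at *; omega) (by simp at *; omega) h1.1 h2.1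
      simp at *; omega
    · have := level_unique (by simp at *; omega) (by simp at *; omega) h1.2 h2.2
      simp at *; omega

theorem dist_lt_of_mem_vadd_base {n : ℕ} {v : Fin 2 → ℤ} (hv : v ∈ box n)
    {p q : space × space} (hp : p ∈ v +ᵥ base n) (hq : q ∈ v +ᵥ base n) :
    dist p q < width n := by
  have key {j : ℕ} {x y : space} (hx : x ∈ levelSet n j) (hy : y ∈ levelSet n j) :
      dist x y < width n := by
    rw [Subtype.dist_eq, Real.dist_eq, abs_lt]
    exact ⟨by linarith [hx.1, hy.2], by linarith [hx.2, hy.1]⟩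
  have hp' := (mem_vadd_base hv).1 hp
  have hq' := (mem_vadd_base hv).1 hq
  exact max_lt (key hp'.1 hq'.1) (key hp'.2 hq'.2)

theorem chaconProductMeasure_compl_tower_le (n : ℕ) :
    chaconProductMeasure (⋃ v ∈ box n, v +ᵥ base n)ᶜ ≤ ENNReal.ofReal (width n) := by
  have hsub : (⋃ v ∈ box n, v +ᵥ base n)ᶜ ⊆
      (towerSet n)ᶜ ×ˢ Set.univ ∪ Set.univ ×ˢ (towerSet n)ᶜ := by
    intro p hp
    by_contra hcon
    simp only [Set.mem_union, Set.mem_prod, Set.mem_compl_iff, Set.mem_univ, and_true, true_and,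
      not_or, not_not] at hcon
    obtain ⟨v, hv, h⟩ := exists_mem_vadd_base hcon.1 hcon.2
    exact hp (Set.mem_biUnion hv h)
  refine (measure_mono hsub).trans ((measure_union_le _ _).trans ?_)
  have hw := width_pos n
  rw [chaconProductMeasure, Measure.prod_prod, Measure.prod_prod, measure_univ,
    chaconMeasure_compl_towerSet, mul_one, one_mul, ← ENNReal.ofReal_add (by positivity)
    (by positivity), add_halves]

/-- A measurable set `A` contains a closed set `C` of almost the same measure, and for large `n`
the tower levels that meet `C` stay within a small neighbourhood of `C`. -/
theorem eventually_exists_symmDiff_le {A : Set (space × space)} (hA : MeasurableSet A)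
    {ε : ENNReal} (hε : 0 < ε) :
    ∀ᶠ n in atTop, ∃ S ⊆ box n,
      chaconProductMeasure (symmDiff (⋃ v ∈ S, v +ᵥ base n) A) ≤ ε := by
  have hε3 : ε / 3 ≠ 0 := (ENNReal.div_pos hε.ne' (by simp)).ne'
  obtain ⟨C, hCA, hC, hCε⟩ := hA.exists_isClosed_sdiff_lt
    (measure_ne_top chaconProductMeasure A) hε3
  have hthick := tendsto_measure_thickening_of_isClosed (μ := chaconProductMeasure)
    ⟨1, one_pos, measure_ne_top _ _⟩ hC
  have hlt : chaconProductMeasure C < chaconProductMeasure C + ε / 3 :=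
    ENNReal.lt_add_right (measure_ne_top _ _) hε3
  obtain ⟨δ, hδ, hδ0⟩ := ((hthick.eventually (gt_mem_nhds hlt)).and self_mem_nhdsWithin).exists
  have hδ' : chaconProductMeasure (Metric.thickening δ C \ C) ≤ ε / 3 := by
    rw [measure_sdiff (Metric.self_subset_thickening hδ0 C) hC.measurableSet.nullMeasurableSet
      (measure_ne_top _ _)]
    exact tsub_le_iff_left.2 hδ.le
  have hw : Tendsto (fun n => ENNReal.ofReal (width n)) atTop (𝓝 0) := by
    simpa using ENNReal.tendsto_ofReal tendsto_width
  filter_upwards [tendsto_width.eventually (gt_mem_nhds hδ0),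
    hw.eventually (gt_mem_nhds (pos_iff_ne_zero.2 hε3))] with n hn hn'
  classical
  refine ⟨(box n).filter fun v => ((v +ᵥ base n) ∩ C).Nonempty, Finset.filter_subset _ _, ?_⟩
  have hsub : symmDiff (⋃ v ∈ (box n).filter fun v => ((v +ᵥ base n) ∩ C).Nonempty,
      v +ᵥ base n) A ⊆
      (Metric.thickening δ C \ C) ∪ (A \ C ∪ (⋃ v ∈ box n, v +ᵥ base n)ᶜ) := by
    rintro p (⟨hp, hpA⟩ | ⟨hpA, hp⟩)
    · left
      refine ⟨?_, fun h => hpA (hCA h)⟩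
      simp only [Set.mem_iUnion, Finset.mem_filter] at hp
      obtain ⟨v, ⟨hv, q, hq, hqC⟩, hpv⟩ := hp
      exact Metric.mem_thickening_iff.2 ⟨q, hqC, (dist_lt_of_mem_vadd_base hv hpv hq).trans hn⟩
    · right
      by_cases hpC : p ∈ C
      · right
        intro hcon
        simp only [Set.mem_iUnion] at hcon
        obtain ⟨v, hv, hpv⟩ := hcon
        exact hp (Set.mem_biUnion (Finset.mem_filter.2 ⟨hv, p, hpv, hpC⟩) hpv)
      · exact Or.inl ⟨hpA, hpC⟩
  calc _ ≤ _ := measure_mono hsub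
    _ ≤ _ := (measure_union_le _ _).trans (add_le_add_right (measure_union_le _ _) _)
    _ ≤ ε / 3 + (ε / 3 + ε / 3) := by
        refine add_le_add hδ' (add_le_add hCε.le ?_)
        exact (chaconProductMeasure_compl_tower_le n).trans hn'.le
    _ = ε := by rw [← add_assoc, ENNReal.add_thirds]

theorem isRankOneFor_box : RankOne.IsRankOneFor chaconProductMeasure box := by
  refine ⟨box_nonempty, base, isTowerBase_base, fun A hA => ?_⟩
  -- At each stage choose the best approximation to `A`.
  have hbest (n : ℕ) : ∃ S ∈ (box n).powerset, ∀ S' ∈ (box n).powerset,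
      chaconProductMeasure (symmDiff (⋃ v ∈ S, v +ᵥ base n) A) ≤
        chaconProductMeasure (symmDiff (⋃ v ∈ S', v +ᵥ base n) A) :=
    Finset.exists_min_image _ _ ⟨∅, by simp⟩
  choose S hS hmin using hbest
  refine ⟨S, fun n => Finset.mem_powerset.1 (hS n), ENNReal.tendsto_nhds_zero.2 fun ε hε => ?_⟩
  filter_upwards [eventually_exists_symmDiff_le hA hε] with n hn
  obtain ⟨S', hS', h⟩ := hn
  exact (hmin n S' (Finset.mem_powerset.2 hS')).trans h

/-- The square and its translate by `v` intersect in a rectangle with sides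
`height n - |v 0|` and `height n - |v 1|`, empty if one of these is negative. -/
theorem card_box_inter_vadd (n : ℕ) (v : Fin 2 → ℤ) :
    (box n ∩ (v +ᵥ box n)).card =
      ((height n : ℤ) - |v 0|).toNat * ((height n : ℤ) - |v 1|).toNat := by
  have e : box n ∩ (v +ᵥ box n) = Fintype.piFinset fun i =>
      Finset.Ico (max 0 (v i)) (min (height n : ℤ) (height n + v i)) := by
    ext w
    simp only [Finset.mem_inter, Finset.mem_vadd_finset, mem_box, Fintype.mem_piFinset,
      Finset.mem_Ico]
    constructor
    · rintro ⟨h, u, hu, rfl⟩ i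
      have h1 := h i
      have h2 := hu i
      simp only [vadd_eq_add, Pi.add_apply] at h1 ⊢
      omega
    · intro h
      refine ⟨fun i => by have := h i; omega, w - v, fun i => ?_, by simp⟩
      have := h i
      simp only [Pi.sub_apply]
      omega
  have hside (a : ℤ) : (Finset.Ico (max 0 a) (min (height n : ℤ) (height n + a))).card =
      ((height n : ℤ) - |a|).toNat := by
    rw [Int.card_Ico]
    congr 1
    rcases abs_cases a with h | h <;> omega
  rw [e, Fintype.card_piFinset, Fin.prod_univ_two, hside, hside]

theorem isFolnerSequence_box : RankOne.IsFolnerSequence box where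
  nonempty := box_nonempty
  tendsto v := by
    have hcast : Tendsto (fun n => (height n : ℝ)) atTop atTop :=
      tendsto_natCast_atTop_atTop.comp tendsto_height
    have hlim (a : ℤ) : Tendsto (fun n => 1 - |(a : ℝ)| / height n) atTop (𝓝 1) := by
      simpa using (hcast.const_div_atTop |(a : ℝ)|).const_sub 1
    have hmain : Tendsto (fun n => 2 - 2 * ((1 - |(v 0 : ℝ)| / height n) *
        (1 - |(v 1 : ℝ)| / height n))) atTop (𝓝 0) := by
      simpa using (((hlim (v 0)).mul (hlim (v 1))).const_mul 2).const_sub 2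
    refine hmain.congr' ?_
    have hge (a : ℤ) : ∀ᶠ n in atTop, |a| ≤ (height n : ℤ) := by
      filter_upwards [tendsto_height.eventually_ge_atTop a.natAbs] with n hn
      rw [Int.abs_eq_natAbs]
      exact_mod_cast hn
    filter_upwards [hge (v 0), hge (v 1)] with n h0 h1
    have hp : (height n : ℝ) ≠ 0 := by exact_mod_cast (height_pos n).ne'
    have hcard : ((symmDiff (box n) (v +ᵥ box n)).card : ℝ) =
        2 * (height n : ℝ) ^ 2 -
          2 * (((height n : ℝ) - |(v 0 : ℝ)|) * ((height n : ℝ) - |(v 1 : ℝ)|)) := by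
      have e1 : (symmDiff (box n) (v +ᵥ box n)).card + 2 * (box n ∩ (v +ᵥ box n)).card =
          2 * height n ^ 2 := by
        have h1 := Finset.card_sdiff_add_card_inter (box n) (v +ᵥ box n)
        have h2 := Finset.card_sdiff_add_card_inter (v +ᵥ box n) (box n)
        rw [Finset.card_vadd_finset] at h2
        rw [Finset.inter_comm] at h2
        rw [symmDiff_def, Finset.sup_eq_union,
          Finset.card_union_of_disjoint disjoint_sdiff_sdiff]
        have := card_box n
        omega
      rw [card_box_inter_vadd] at e1
      have e2 : (((height n : ℤ) - |v 0|).toNat : ℝ) = height n - |(v 0 : ℝ)| := by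
        have : (((height n : ℤ) - |v 0|).toNat : ℤ) = height n - |v 0| :=
          Int.toNat_of_nonneg (by omega)
        exact_mod_cast this
      have e3 : (((height n : ℤ) - |v 1|).toNat : ℝ) = height n - |(v 1 : ℝ)| := by
        have : (((height n : ℤ) - |v 1|).toNat : ℤ) = height n - |v 1| :=
          Int.toNat_of_nonneg (by omega)
        exact_mod_cast this
      have e4 := congrArg (Nat.cast (R := ℝ)) e1
      push_cast at e4
      rw [e2, e3] at e4
      linarith
    rw [hcard, card_box]
    push_cast
    field_simp

theorem isFolnerRankOne_chaconProductMeasure :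
    RankOne.IsFolnerRankOne 2 chaconProductMeasure :=
  ⟨box, isFolnerSequence_box, isRankOneFor_box⟩

/-! ### Absence of finite odometer factors -/

/-- A set of positive measure fills most of some tower level: a union of levels approximating
the set consists mostly of points of the set, and so does one of these levels. -/
theorem exists_vadd_base_diff_lt {A : Set (space × space)} (hA : MeasurableSet A)
    (hpos : chaconProductMeasure A ≠ 0) :
    ∃ n, ∃ v ∈ box n,
      9 * chaconProductMeasure ((v +ᵥ base n) \ A) < chaconProductMeasure (base n) := by
  by_contra! hcon
  set a := (chaconProductMeasure A).toReal with ha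
  have ha0 : 0 < a := ENNReal.toReal_pos hpos (measure_ne_top _ _)
  obtain ⟨n, S, hS, hle⟩ := (eventually_exists_symmDiff_le hA
    (ENNReal.ofReal_pos.2 (show 0 < a / 11 by positivity))).exists
  have hdisj : Set.PairwiseDisjoint (S : Set (Fin 2 → ℤ)) fun v => v +ᵥ base n :=
    fun v hv w hw hvw => (isTowerBase_base n).disjoint v (hS hv) w (hS hw) hvw
  have hmeas (v : Fin 2 → ℤ) : MeasurableSet (v +ᵥ base n) :=
    (measurableSet_base n).const_vadd v
  have hU : chaconProductMeasure (⋃ v ∈ S, v +ᵥ base n) ≤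
      9 * chaconProductMeasure ((⋃ v ∈ S, v +ᵥ base n) \ A) := by
    have e : (⋃ v ∈ S, v +ᵥ base n) \ A = ⋃ v ∈ S, (v +ᵥ base n) \ A := by
      simp only [Set.iUnion_sdiff]
    rw [e, measure_biUnion_finset hdisj fun v _ => hmeas v,
      measure_biUnion_finset (hdisj.mono fun v => Set.sdiff_subset)
        fun v _ => (hmeas v).diff hA, Finset.mul_sum]
    refine Finset.sum_le_sum fun v hv => ?_
    rw [measure_vadd]
    exact hcon n v (hS hv)
  have hA' : chaconProductMeasure A ≤ ENNReal.ofReal (10 * (a / 11)) := by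
    calc chaconProductMeasure A
        ≤ chaconProductMeasure ((⋃ v ∈ S, v +ᵥ base n) ∪ A \ ⋃ v ∈ S, v +ᵥ base n) :=
          measure_mono fun x hx => by
            by_cases h : x ∈ ⋃ v ∈ S, v +ᵥ base n
            · exact Or.inl h
            · exact Or.inr ⟨hx, h⟩
      _ ≤ 9 * ENNReal.ofReal (a / 11) + ENNReal.ofReal (a / 11) := by
          refine (measure_union_le _ _).trans (add_le_add (hU.trans ?_) ?_)
          · gcongr
            exact (measure_mono le_sup_left).trans hle
          · exact (measure_mono le_sup_right).trans hle
      _ = ENNReal.ofReal (10 * (a / 11)) := by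
          rw [ENNReal.ofReal_mul (by norm_num), ENNReal.ofReal_ofNat]
          ring
  have := ENNReal.toReal_le_of_le_ofReal (by positivity) hA'
  linarith

/-- The first third of the bottom level of stage `n` returns to the bottom level after `height n`
steps, and again after `height n + 1` further steps, because of the spacer. -/
theorem chaconMap_pow_mem_of_mem_levelSet_succ {n : ℕ} {x : space} (hx : x ∈ levelSet (n + 1) 0) :
    x ∈ levelSet n 0 ∧ (chaconMap ^ height n) x ∈ levelSet n 0 ∧
      (chaconMap ^ (2 * height n + 1)) x ∈ levelSet n 0 := by
  have hp := height_pos n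
  have hh : height (n + 1) = 3 * height n + 1 := rfl
  have hs := width_succ n
  have hw := width_pos (n + 1)
  refine ⟨?_, ?_, ?_⟩
  · obtain ⟨a, b⟩ := hx
    rw [left_first hp] at a b
    exact ⟨a, by linarith⟩
  · obtain ⟨a, b⟩ := (chaconMap_pow_mem_levelSet (n := n + 1) (j := height n) (by omega)).2 hx
    rw [← zero_add (height n), left_second hp] at a b
    rw [← zero_add (height n)]
    exact ⟨by linarith, by linarith⟩
  · obtain ⟨a, b⟩ :=
      (chaconMap_pow_mem_levelSet (n := n + 1) (j := 2 * height n + 1) (by omega)).2 hx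
    rw [← zero_add (2 * height n + 1), left_third] at a b
    rw [← zero_add (2 * height n + 1)]
    exact ⟨by linarith, by linarith⟩

/-- In either coordinate direction, a third of the base of the product tower returns to the base
under translation by `height n` and by `2 * height n + 1`. -/
theorem exists_third_of_base (n : ℕ) (i : Fin 2) : ∃ C : Set (space × space),
    chaconProductMeasure (base n) = 3 * chaconProductMeasure C ∧
    ∀ p ∈ C, p ∈ base n ∧ (Pi.single i (height n : ℤ) : Fin 2 → ℤ) +ᵥ p ∈ base n ∧
      (Pi.single i (2 * height n + 1 : ℤ) : Fin 2 → ℤ) +ᵥ p ∈ base n := by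
  have hw : ENNReal.ofReal (width n) = 3 * ENNReal.ofReal (width (n + 1)) := by
    rw [width_succ, ENNReal.ofReal_mul (by norm_num), ENNReal.ofReal_ofNat]
  have hpow (x : space) :
      (chaconMap ^ (2 * height n + 1 : ℤ)) x = (chaconMap ^ (2 * height n + 1)) x := by
    rw [← zpow_natCast]; push_cast; rfl
  fin_cases i
  · refine ⟨levelSet (n + 1) 0 ×ˢ levelSet n 0, ?_, fun p hp => ?_⟩
    · simp only [base, chaconProductMeasure, Measure.prod_prod,
        chaconMeasure_levelSet (height_pos _)]
      rw [hw, mul_assoc]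
    · obtain ⟨h0, h1, h2⟩ := chaconMap_pow_mem_of_mem_levelSet_succ hp.1
      refine ⟨⟨h0, hp.2⟩, ?_, ?_⟩
      · simpa [vadd_def, base] using ⟨h1, hp.2⟩
      · simpa [vadd_def, base, hpow] using ⟨h2, hp.2⟩
  · refine ⟨levelSet n 0 ×ˢ levelSet (n + 1) 0, ?_, fun p hp => ?_⟩
    · simp only [base, chaconProductMeasure, Measure.prod_prod,
        chaconMeasure_levelSet (height_pos _)]
      rw [hw, mul_left_comm]
    · obtain ⟨h0, h1, h2⟩ := chaconMap_pow_mem_of_mem_levelSet_succ hp.2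
      refine ⟨⟨hp.1, h0⟩, ?_, ?_⟩
      · simpa [vadd_def, base] using ⟨hp.1, h1⟩
      · simpa [vadd_def, base, hpow] using ⟨hp.1, h2⟩

/-- Let `f` be an equivariant map to `ℤ² / G` and `v +ᵥ base n` a level on which `f` is mostly
equal to `q`. Some point of this level and its translates by `height n` and by `2 * height n + 1`
in the direction `i` all lie where `f = q`. So both translations fix `q`, and `G` contains the
unit vector in the direction `i`. -/
theorem single_one_mem_of_equivariant {G : AddSubgroup (Fin 2 → ℤ)}
    {f : space × space → (Fin 2 → ℤ) ⧸ G}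
    (hf : ∀ v : Fin 2 → ℤ, ∀ᵐ p ∂chaconProductMeasure, f (v +ᵥ p) = v +ᵥ f p)
    {n : ℕ} {v : Fin 2 → ℤ} {q : (Fin 2 → ℤ) ⧸ G}
    (hlt : 9 * chaconProductMeasure ((v +ᵥ base n) \ f ⁻¹' {q}) < chaconProductMeasure (base n))
    (i : Fin 2) : (Pi.single i 1 : Fin 2 → ℤ) ∈ G := by
  obtain ⟨C, hC, hCmem⟩ := exists_third_of_base n i
  set w₁ : Fin 2 → ℤ := Pi.single i (height n : ℤ) with hw₁
  set w₂ : Fin 2 → ℤ := Pi.single i (2 * height n + 1 : ℤ) with hw₂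
  set D := (v +ᵥ base n) \ f ⁻¹' {q} with hD
  obtain ⟨p, hpC, hgood, h0, h1, h2⟩ : ∃ p ∈ C,
      (f (v +ᵥ p) = v +ᵥ f p ∧ f ((v + w₁) +ᵥ p) = (v + w₁) +ᵥ f p ∧
        f ((v + w₂) +ᵥ p) = (v + w₂) +ᵥ f p) ∧
      v +ᵥ p ∉ D ∧ (v + w₁) +ᵥ p ∉ D ∧ (v + w₂) +ᵥ p ∉ D := by
    by_contra! hcon
    have hsub : C ⊆ {p | ¬ (f (v +ᵥ p) = v +ᵥ f p ∧ f ((v + w₁) +ᵥ p) = (v + w₁) +ᵥ f p ∧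
        f ((v + w₂) +ᵥ p) = (v + w₂) +ᵥ f p)} ∪ ((v +ᵥ ·) ⁻¹' D ∪
          (((v + w₁) +ᵥ ·) ⁻¹' D ∪ ((v + w₂) +ᵥ ·) ⁻¹' D)) := by
      intro p hp
      by_contra h
      simp only [Set.mem_union, Set.mem_ofPred_eq, Set.mem_preimage, not_or, not_not] at h
      exact h.2.2.2 (hcon p hp h.1 h.2.1 h.2.2.1)
    have hnull : chaconProductMeasure {p | ¬ (f (v +ᵥ p) = v +ᵥ f p ∧
        f ((v + w₁) +ᵥ p) = (v + w₁) +ᵥ f p ∧ f ((v + w₂) +ᵥ p) = (v + w₂) +ᵥ f p)} = 0 :=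
      ae_iff.1 ((hf v).and ((hf (v + w₁)).and (hf (v + w₂))))
    have hle : chaconProductMeasure C ≤ 3 * chaconProductMeasure D := by
      refine (measure_mono hsub).trans ((measure_union_le _ _).trans ?_)
      rw [hnull, zero_add]
      refine (measure_union_le _ _).trans
        ((add_le_add_right (measure_union_le _ _) _).trans (le_of_eq ?_))
      rw [measure_preimage_vadd, measure_preimage_vadd, measure_preimage_vadd]
      ring
    refine absurd hlt (not_lt.2 ?_)
    calc chaconProductMeasure (base n) = 3 * chaconProductMeasure C := hC
      _ ≤ 3 * (3 * chaconProductMeasure D) := by gcongr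
      _ = 9 * chaconProductMeasure D := by rw [← mul_assoc]; norm_num
  obtain ⟨hb0, hb1, hb2⟩ := hCmem p hpC
  have hval {u : Fin 2 → ℤ} (hu : u +ᵥ p ∈ base n) (h : (v + u) +ᵥ p ∉ D) :
      f ((v + u) +ᵥ p) = q := by
    by_contra hq
    exact h ⟨by rw [add_vadd]; exact Set.vadd_mem_vadd_set hu, hq⟩
  have hmem {u : Fin 2 → ℤ} (hu : u +ᵥ p ∈ base n) (h : (v + u) +ᵥ p ∉ D)
      (he : f ((v + u) +ᵥ p) = (v + u) +ᵥ f p) : u ∈ G := by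
    have e0 := hval (u := 0) (by simpa using hb0) (by simpa using h0)
    rw [add_zero, hgood.1] at e0
    rw [hval hu h, ← e0] at he
    generalize f p = r at he
    induction r using QuotientAddGroup.induction_on with
    | H g =>
      have he' : ((v + g : Fin 2 → ℤ) : (Fin 2 → ℤ) ⧸ G) = ((v + u + g : Fin 2 → ℤ) : _) := he
      rw [QuotientAddGroup.eq] at he'
      convert he' using 1
      abel
  have hm₁ := hmem hb1 h1 hgood.2.1
  have hm₂ := hmem hb2 h2 hgood.2.2
  have e : (Pi.single i 1 : Fin 2 → ℤ) = w₂ - w₁ - w₁ := by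
    rw [hw₁, hw₂, ← Pi.single_sub, ← Pi.single_sub]
    congr 1; ring
  rw [e]
  exact G.sub_mem (G.sub_mem hm₂ hm₁) hm₁

theorem eq_top_of_equivariant {G : AddSubgroup (Fin 2 → ℤ)} [G.FiniteIndex]
    {f : space × space → (Fin 2 → ℤ) ⧸ G} (hfm : Measurable f)
    (hf : ∀ v : Fin 2 → ℤ, ∀ᵐ p ∂chaconProductMeasure, f (v +ᵥ p) = v +ᵥ f p) : G = ⊤ := by
  have : Finite ((Fin 2 → ℤ) ⧸ G) := AddSubgroup.finite_quotient_of_finiteIndex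
  obtain ⟨q, hq⟩ : ∃ q, chaconProductMeasure (f ⁻¹' {q}) ≠ 0 := by
    by_contra! h
    have h' := measure_iUnion_null h
    rw [← Set.preimage_iUnion, Set.iUnion_of_singleton, Set.preimage_univ, measure_univ] at h'
    exact one_ne_zero h'
  obtain ⟨n, v, -, hlt⟩ := exists_vadd_base_diff_lt (hfm (measurableSet_singleton q)) hq
  refine (AddSubgroup.eq_top_iff' G).2 fun u => ?_
  rw [← Finset.univ_sum_single u]
  refine G.sum_mem fun i _ => ?_
  have h := G.zsmul_mem (single_one_mem_of_equivariant hf hlt i) (u i)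
  rwa [← Pi.single_smul, smul_eq_mul, mul_one] at h

end Chacon

theorem mainTheorem9 :
    RankOne.IsLebesgueProbabilitySpace (Chacon.space × Chacon.space)
      Chacon.chaconProductMeasure ∧
    RankOne.IsMeasurePreservingAction (Fin 2 → ℤ) Chacon.chaconProductMeasure ∧
    RankOne.IsFolnerRankOne 2 Chacon.chaconProductMeasure ∧
    ¬ RankOne.IsTotallyErgodic (Fin 2 → ℤ) Chacon.chaconProductMeasure ∧
    ∀ (Z : Type*) [MeasurableSpace Z] [AddAction (Fin 2 → ℤ) Z] (ζ : Measure Z),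
      RankOne.IsNontrivialFiniteOdometer 2 ζ →
        ¬ RankOne.FactorsOnto (Fin 2 → ℤ) Chacon.chaconProductMeasure ζ := by
  refine ⟨Chacon.isLebesgueProbabilitySpace_chaconProductMeasure,
    Chacon.isMeasurePreservingAction_chaconProductMeasure,
    Chacon.isFolnerRankOne_chaconProductMeasure,
    Chacon.not_isTotallyErgodic_chaconProductMeasure, ?_⟩
  rintro Z _ _ ζ ⟨G, hG, hfin, ψ, hψ, -⟩ ⟨φ, hφ⟩
  refine hG (Chacon.eq_top_of_equivariant (hψ.measurable.comp hφ.measurable) fun v => ?_)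
  have h : ∀ᵐ p ∂Chacon.chaconProductMeasure, ψ (v +ᵥ φ p) = v +ᵥ ψ (φ p) := by
    have h' := hψ.equivariant v
    rw [← hφ.map_eq] at h'
    exact ae_of_ae_map hφ.measurable.aemeasurable h'
  filter_upwards [h, hφ.equivariant v] with p h1 h2
  rw [Function.comp_apply, Function.comp_apply, h2, h1]
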